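/- Let $S_n$ be the set of permutations of $[n]=\{1,\dots,n\}$; view $\sigma\in S_n$ as a deck of $n$ cards laid out in a row, $\sigma_j$ being the number of the card in the $j$-th position from the left. In the card-cyclic to random insertion shuffle, each of the $n$ cards is removed from the deck and reinserted exactly once, in the original left to right order of the cards; the $n$ positions in which the cards are reinserted are independent and uniformly distributed on $[n]$. Let $p_n(\mathrm{id},\cdot)$ be the distribution on $S_n$ of the deck after this shuffle, started from the identity. Under $p_n(\mathrm{id},\cdot)$, the number $\sigma_n$ of the card in the last position has the following behavior. (In (i) and (ii), $b_n$ is such that $b_nn\in[n]$.) (i) If $\lim_{n\to\infty}b_n=b\in[0,1)$, then $$\lim_{n\to\infty}n\,p_n(\mathrm{id},\{\sigma_n=b_nn\})=\frac{e^b}{e-1}.$$ In particular, the probability measures $\nu_n^{\mathrm L}$ on $[0,1]$ defined by $\nu_n^{\mathrm L}(A)=p_n(\mathrm{id},\{\sigma_n\in nA\})$, $A\subset[0,1]$, converge weakly, as $n\to\infty$, to the probability measure $\frac{e^x}{e-1}\,dx$ on $[0,1]$. (ii) If $\lim_{n\to\infty}b_n=1$ and $\lim_{n\to\infty}(n-b_nn)=\infty$,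 then $$\lim_{n\to\infty}n\,p_n(\mathrm{id},\{\sigma_n=b_nn\})=\frac{e}{e-1}.$$ (iii) For every fixed $l=0,1,2,\dots$, $$\lim_{n\to\infty}n\,p_n(\mathrm{id},\{\sigma_n=n-l\})=\frac{e-e^{-l}}{e-1}.$$ -/

import Mathlib

open Filter Topology MeasureTheory

namespace CardCyclic

/-- A deck of `n` cards is a permutation `σ : Equiv.Perm (Fin n)`: `σ i` is the card in position
`i`, counted from the left. Positions and cards are indexed by `0, …, n - 1`, so that the position
and the number of a card in the usual counting `1, …, n` are obtained by adding `1`.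

`reinsert τ c k` is the deck obtained from `τ` by removing the card `c` and reinserting it so that
it occupies position `k`; the other cards keep their relative order. Explicitly, if `p` is the
position of `c` in `τ`, the new deck has `c` in position `k`, and its `i`-th card when position `k`
is skipped is the `i`-th card of `τ` when position `p` is skipped. -/
def reinsert : {n : ℕ} → Equiv.Perm (Fin n) → Fin n → Fin n → Equiv.Perm (Fin n)
  | 0, τ, _, _ => τ
  | _ + 1, τ, c, k => ((finSuccEquiv' k).trans (finSuccEquiv' (τ.symm c)).symm).trans τ

/-- The deck after the first `i` removals and reinsertions, if the initial deck is `σ` and the card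
that was originally in position `j` is reinserted in position `k j`. The cards are treated in the
left to right order of the initial deck `σ`. -/
def deckAfter {n : ℕ} (σ : Equiv.Perm (Fin n)) (k : Fin n → Fin n) : ℕ → Equiv.Perm (Fin n)
  | 0 => σ
  | i + 1 =>
    if h : i < n then reinsert (deckAfter σ k i) (σ ⟨i, h⟩) (k ⟨i, h⟩) else deckAfter σ k i

instance instNonemptyChoices (n : ℕ) : Nonempty (Fin n → Fin n) := ⟨id⟩

/-- The law `p_n(σ, ·)` of the deck after one card-cyclic to random insertion shuffle started
from `σ`: each of the `n` cards is removed and reinserted once, in the left to right order of `σ`,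
the `n` reinsertion positions being independent and uniform (so that the `n ^ n` choices of
reinsertion positions are equally likely). -/
noncomputable def shuffleLaw {n : ℕ} (σ : Equiv.Perm (Fin n)) : PMF (Equiv.Perm (Fin n)) :=
  (PMF.uniformOfFintype (Fin n → Fin n)).map (fun k => deckAfter σ k n)

/-- The number `σ_n ∈ {1, …, n}` of the card in the last position (by convention `0` for the empty
deck). -/
def lastCard : {n : ℕ} → Equiv.Perm (Fin n) → ℕ
  | 0, _ => 0
  | n + 1, σ => (σ (Fin.last n)).val + 1

lemma lastCard_le : ∀ {n : ℕ} (σ : Equiv.Perm (Fin n)), lastCard σ ≤ n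
  | 0, _ => le_rfl
  | n + 1, σ => (σ (Fin.last n)).isLt

/-- The probability `p_n(id, {σ_n = x})`. -/
noncomputable def probLast (n : ℕ) (x : ℝ) : ℝ :=
  ((shuffleLaw (1 : Equiv.Perm (Fin n))).toOuterMeasure {σ | (lastCard σ : ℝ) = x}).toReal

/-- The rescaled number `σ_n / n ∈ [0, 1]` of the card in the last position. -/
noncomputable def scaledLast {n : ℕ} (σ : Equiv.Perm (Fin n)) : unitInterval :=
  ⟨(lastCard σ : ℝ) / n, by positivity,
    div_le_one_of_le₀ (by exact_mod_cast lastCard_le σ) (Nat.cast_nonneg n)⟩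

/-- The probability measure on `[0, 1]` which assigns `p_n(id, {σ_n ∈ nA})` to `A`,
that is, the law of `σ_n / n` under `p_n(id, ·)`. -/
noncomputable def nuLast (n : ℕ) : ProbabilityMeasure unitInterval :=
  ⟨((shuffleLaw (1 : Equiv.Perm (Fin n))).map scaledLast).toMeasure, inferInstance⟩

/-- The measure `e^x / (e - 1) dx` on `[0, 1]`. -/
noncomputable def limitMeasure : Measure unitInterval :=
  volume.withDensity (fun x => ENNReal.ofReal (Real.exp (x : ℝ) / (Real.exp 1 - 1)))

instance instIsProbabilityMeasureLimit : IsProbabilityMeasure limitMeasure := by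
  have he : (0 : ℝ) < Real.exp 1 - 1 := by
    have := Real.add_one_lt_exp (one_ne_zero : (1 : ℝ) ≠ 0)
    linarith
  constructor
  have hcont : Continuous fun x : ℝ => Real.exp x / (Real.exp 1 - 1) := by fun_prop
  rw [limitMeasure, withDensity_apply _ MeasurableSet.univ, Measure.restrict_univ]
  have h1 : ∫⁻ x : unitInterval, ENNReal.ofReal (Real.exp (x : ℝ) / (Real.exp 1 - 1))
      = ∫⁻ x in Set.Icc (0 : ℝ) 1, ENNReal.ofReal (Real.exp x / (Real.exp 1 - 1)) :=
    lintegral_subtype_comap measurableSet_Icc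
      (fun x : ℝ => ENNReal.ofReal (Real.exp x / (Real.exp 1 - 1)))
  rw [h1, ← ofReal_integral_eq_lintegral_ofReal (hcont.integrableOn_Icc)
      (Eventually.of_forall fun x => by positivity),
    integral_Icc_eq_integral_Ioc, ← intervalIntegral.integral_of_le zero_le_one,
    intervalIntegral.integral_div, integral_exp, Real.exp_zero, div_self he.ne',
    ENNReal.ofReal_one]

/-- The probability measure `e^x / (e - 1) dx` on `[0, 1]`. -/
noncomputable def limitLaw : ProbabilityMeasure unitInterval :=
  ⟨limitMeasure, inferInstance⟩

end CardCyclic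

namespace CardCyclic

/-! Let card `c` (numbered from 0) be reinserted at `m = k c`. It ends last when, at that time,
exactly the untouched cards `m + 1, …, n - 1` lie to its right, and every later card is put back to
its left. Each condition bounds the choice for one card separately (`EndsLast`), and exactly one `c`
meets them (`deckAfter_last_eq_iff`). The favourable choices are thus counted by products. With `r =
n - 1 - m` cards to the right, `n` times the probability is the sum of `lastWeight n c r` over `r <
n - c`. If `c / n → b`, the weight tends to `e^(-rb) e^(-(r+1)(1-b)) = e^(b-1) e^(-r)`, and it is at
most `e^(-r/2)`, so dominated convergence applies to the sum. The full geometric series gives `e^b /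
(e - 1)`; if `c = n - 1 - l`, only `r ≤ l` remain and the truncated series gives (iii). The same
bound, uniform in `c`, turns the local limit into weak convergence. -/

/-! ### Which card ends last, in terms of the reinsertion positions. -/

lemma reinsert_apply_self {n : ℕ} (τ : Equiv.Perm (Fin n)) (c k : Fin n) :
    reinsert τ c k k = c := by
  cases n with
  | zero => exact k.elim0
  | succ n => simp [reinsert]

lemma reinsert_apply_of_gt {n : ℕ} (τ : Equiv.Perm (Fin n)) {c k x : Fin n}
    (hk : k < x) (hc : τ.symm c < x) : reinsert τ c k x = τ x := by
  cases n with
  | zero => exact k.elim0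
  | succ n =>
    have hx : x ≠ 0 := ((Fin.zero_le k).trans_lt hk).ne'
    obtain ⟨y, rfl⟩ := Fin.exists_succ_eq.2 hx
    have h1 : finSuccEquiv' k y.succ = some y :=
      finSuccEquiv'_above (Fin.le_castSucc_iff.2 hk)
    have h2 : (finSuccEquiv' (τ.symm c)).symm (some y) = y.succ :=
      finSuccEquiv'_symm_some_above (Fin.le_castSucc_iff.2 hc)
    simp only [reinsert, Equiv.trans_apply, h1, h2]

lemma reinsert_apply_of_eq {n : ℕ} (τ : Equiv.Perm (Fin n)) {c k x y : Fin n}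
    (hk : k < x) (hc : τ.symm c = x) (hy : y.val + 1 = x.val) : reinsert τ c k x = τ y := by
  cases n with
  | zero => exact k.elim0
  | succ n =>
    have hx : x ≠ 0 := ((Fin.zero_le k).trans_lt hk).ne'
    obtain ⟨z, rfl⟩ := Fin.exists_succ_eq.2 hx
    have h1 : finSuccEquiv' k z.succ = some z :=
      finSuccEquiv'_above (Fin.le_castSucc_iff.2 hk)
    have h2 : (finSuccEquiv' (τ.symm c)).symm (some z) = z.castSucc := by
      rw [hc]
      exact finSuccEquiv'_symm_some_below (Fin.castSucc_lt_succ)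
    have h3 : z.castSucc = y := by
      ext
      simp at hy ⊢
      omega
    simp only [reinsert, Equiv.trans_apply, h1, h2, h3]

lemma deckAfter_succ {n : ℕ} (k : Fin n → Fin n) (i : Fin n) :
    deckAfter 1 k (i + 1) = reinsert (deckAfter 1 k i) i (k i) := by
  simp [deckAfter]

/-- The reinsertion positions for which the card `c` ends up in the last position. -/
def EndsLast {n : ℕ} (k : Fin n → Fin n) (c : Fin n) : Prop :=
  c ≤ k c ∧ (∀ i < c, k i ≤ k c) ∧ ∀ j, c < j → k j < max (k c) j

instance {n : ℕ} (k : Fin n → Fin n) (c : Fin n) : Decidable (EndsLast k c) := by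
  unfold EndsLast; infer_instance

/-- Before the turn of `c` nothing is inserted beyond `k c`, and nothing is removed from there,
since the cards there have numbers above `k c ≥ c`. -/
lemma EndsLast.deckAfter_of_le {n : ℕ} {k : Fin n → Fin n} {c : Fin n} (h : EndsLast k c) :
    ∀ t ≤ c.val, ∀ x, k c < x → deckAfter 1 k t x = x := by
  intro t
  induction t with
  | zero => intro _ x _; rfl
  | succ t ih =>
    intro ht x hx
    have hlt : t < n := by omega
    have htc : (⟨t, hlt⟩ : Fin n) < c := Fin.lt_def.2 (by simpa using ht)
    have ih' := ih (by omega)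
    rw [deckAfter_succ k ⟨t, hlt⟩, reinsert_apply_of_gt, ih' x hx]
    · exact (h.2.1 _ htc).trans_lt hx
    · refine lt_of_le_of_lt ?_ hx
      by_contra! hp
      have := ih' _ hp
      rw [Equiv.apply_symm_apply] at this
      rw [← this] at hp
      exact absurd (h.1.trans_lt hp) htc.not_gt

/-- Card `c` waits at `k c` while the cards up to number `k c` are treated to its left. After that,
each treated card jumps from just right of `c` to its left, pushing `c` one place on. -/
lemma EndsLast.deckAfter_of_gt {n : ℕ} {k : Fin n → Fin n} {c : Fin n} (h : EndsLast k c) :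
    ∀ t : Fin n, c ≤ t → deckAfter 1 k (t + 1) (max (k c) t) = c ∧
      ∀ x, max (k c) t < x → deckAfter 1 k (t + 1) x = x := by
  rintro ⟨t, hlt⟩ hct
  have hct' : c.val ≤ t := hct
  clear hct
  induction t, hct' using Nat.le_induction with
  | base =>
    have hfix := h.deckAfter_of_le c le_rfl
    have hpos : (deckAfter 1 k c).symm c ≤ k c := by
      by_contra! hp
      have := hfix _ hp
      rw [Equiv.apply_symm_apply] at this
      rw [← this] at hp
      exact absurd h.1 hp.not_ge
    simp only [Fin.eta, max_eq_left h.1, deckAfter_succ]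
    refine ⟨reinsert_apply_self _ _ _, fun x hx => ?_⟩
    rw [reinsert_apply_of_gt _ hx (hpos.trans_lt hx), hfix x hx]
  | succ t hct ih =>
    obtain ⟨ih1, ih2⟩ := ih (by omega)
    set j : Fin n := ⟨t + 1, hlt⟩ with hj
    set i : Fin n := ⟨t, by omega⟩ with hi
    have hcj : c < j := Fin.lt_def.2 (by simp [hj]; omega)
    have hij : i < j := Fin.lt_def.2 (by simp [hj, hi])
    have hkj := h.2.2 j hcj
    set τ := deckAfter 1 k (t + 1) with hτ
    have hstep : deckAfter 1 k (j + 1) = reinsert τ j (k j) := deckAfter_succ k j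
    change deckAfter 1 k (j + 1) _ = _ ∧ ∀ x, _ → deckAfter 1 k (j + 1) x = x
    change τ _ = c at ih1
    change ∀ x, _ → τ x = x at ih2
    rw [hstep]
    rcases le_or_gt j (k c) with hjm | hmj
    · have him : i ≤ k c := hij.le.trans hjm
      rw [max_eq_left him] at ih1 ih2
      rw [max_eq_left hjm] at hkj ⊢
      -- Positions beyond `k c` hold their own numbers, which exceed `j`, and position `k c` holds
      -- `c`.
      have hpos : τ.symm j < k c := by
        by_contra! hp
        rcases hp.lt_or_eq with hp | hp
        · have := ih2 _ hp
          rw [Equiv.apply_symm_apply] at this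
          rw [← this] at hp
          exact absurd hjm hp.not_ge
        · have := congrArg τ hp
          rw [Equiv.apply_symm_apply, ih1] at this
          exact hcj.ne this
      refine ⟨?_, fun x hx => ?_⟩
      · rw [reinsert_apply_of_gt _ hkj hpos, ih1]
      · rw [reinsert_apply_of_gt _ (hkj.trans hx) (hpos.trans hx), ih2 x hx]
    · have hmi : k c ≤ i := Fin.le_def.2 (by
        have := Fin.lt_def.1 hmj
        simp [hj] at this
        simp [hi]; omega)
      rw [max_eq_right hmi] at ih1 ih2
      rw [max_eq_right hmj.le] at hkj ⊢
      have hpos : τ.symm j = j := by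
        rw [Equiv.symm_apply_eq, ih2 j hij]
      refine ⟨?_, fun x hx => ?_⟩
      · rw [reinsert_apply_of_eq _ hkj hpos (y := i) rfl, ih1]
      · rw [reinsert_apply_of_gt _ (hkj.trans hx) (hpos.trans_lt hx), ih2 x (hij.trans hx)]

lemma EndsLast.deckAfter_last {n : ℕ} {k : Fin (n + 1) → Fin (n + 1)} {c : Fin (n + 1)}
    (h : EndsLast k c) : deckAfter 1 k (n + 1) (Fin.last n) = c := by
  have := (h.deckAfter_of_gt (Fin.last n) (Fin.le_last c)).1
  rwa [max_eq_right (Fin.le_last _)] at this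

/-- Among the cards with `j ≤ k j`, take one with the largest reinsertion position, and the last
such card in case of ties. The set is nonempty because it contains card 0. -/
lemma exists_endsLast {n : ℕ} (k : Fin (n + 1) → Fin (n + 1)) : ∃ c, EndsLast k c := by
  classical
  let E := Finset.univ.filter fun j => j ≤ k j
  have hE : E.Nonempty := ⟨0, by simp [E]⟩
  obtain ⟨a, haE, ha⟩ := E.exists_max_image k hE
  let F := E.filter fun j => k j = k a
  have hF : F.Nonempty := ⟨a, by simp [F, haE]⟩
  obtain ⟨c, hcF, hc⟩ := F.exists_max_image id hF
  simp only [F, E, Finset.mem_filter, Finset.mem_univ, true_and, id, and_imp] at hcF hc ha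
  refine ⟨c, hcF.1, fun i hi => ?_, fun j hj => ?_⟩
  · rcases le_or_gt i (k i) with h | h
    · exact hcF.2 ▸ ha i h
    · exact (h.trans (hi.trans_le hcF.1)).le
  · rcases le_or_gt j (k j) with h | h
    · refine lt_max_of_lt_left ?_
      rw [hcF.2]
      exact (ha j h).lt_of_ne fun he => absurd (hc j h he) hj.not_ge
    · exact lt_max_of_lt_right h

/-- Some card satisfies `EndsLast` and is then the last one, so the failure of the conditions needs
no separate analysis. -/
lemma deckAfter_last_eq_iff {n : ℕ} (k : Fin (n + 1) → Fin (n + 1)) (c : Fin (n + 1)) :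
    deckAfter 1 k (n + 1) (Fin.last n) = c ↔ EndsLast k c := by
  refine ⟨fun h => ?_, fun h => h.deckAfter_last⟩
  obtain ⟨c', h'⟩ := exists_endsLast k
  rwa [← h, h'.deckAfter_last]

/-! ### Counting the favourable choices. -/

/-- The positions allowed for card `i` if `c` is reinserted in position `m` and ends up last. -/
def allowedPositions {n : ℕ} (c m i : Fin n) : Finset (Fin n) :=
  if i < c then Finset.Iic m else if i = c then {m} else Finset.Iio (max m i)

lemma filter_endsLast {n : ℕ} (c : Fin n) :
    Finset.univ.filter (fun k : Fin n → Fin n => EndsLast k c) =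
      (Finset.Ici c).biUnion fun m => Fintype.piFinset (allowedPositions c m) := by
  ext k
  simp only [Finset.mem_filter, Finset.mem_univ, true_and, Finset.mem_biUnion, Finset.mem_Ici,
    Fintype.mem_piFinset]
  constructor
  · intro h
    refine ⟨k c, h.1, fun i => ?_⟩
    unfold allowedPositions
    split_ifs with h1 h2
    · exact Finset.mem_Iic.2 (h.2.1 i h1)
    · simp [h2]
    · exact Finset.mem_Iio.2 (h.2.2 i (lt_of_le_of_ne (not_lt.1 h1) (Ne.symm h2)))
  · rintro ⟨m, hm, h⟩
    have hc : k c = m := by simpa [allowedPositions] using h c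
    subst hc
    refine ⟨hm, fun i hi => by simpa [allowedPositions, hi] using h i, fun j hj => ?_⟩
    simpa [allowedPositions, hj.not_gt, hj.ne'] using h j

lemma card_filter_endsLast {n : ℕ} (c : Fin n) :
    (Finset.univ.filter (fun k : Fin n → Fin n => EndsLast k c)).card =
      ∑ m ∈ Finset.Ici c, ∏ i, (allowedPositions c m i).card := by
  rw [filter_endsLast, Finset.card_biUnion]
  · simp only [Fintype.card_piFinset]
  · intro m _ m' _ hne
    refine Finset.disjoint_left.2 fun k hk hk' => hne ?_
    have h := Fintype.mem_piFinset.1 hk c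
    have h' := Fintype.mem_piFinset.1 hk' c
    simp only [allowedPositions, lt_irrefl, if_false, if_true, Finset.mem_singleton] at h h'
    exact h.symm.trans h'

lemma card_allowedPositions {n : ℕ} (c m i : Fin n) :
    (allowedPositions c m i).card =
      if i.val < c then m.val + 1 else if i.val = c then 1 else max m.val i := by
  unfold allowedPositions
  simp only [← Fin.lt_def, ← Fin.ext_iff]
  split_ifs
  · simp
  · simp
  · rw [Fin.card_Iio]
    exact Fin.val_strictMono.monotone.map_max

/-- `n` times the probability that card `c` (counted from `0`) ends up in the last position, with
`r` cards to its right just after its reinsertion. -/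
noncomputable def lastWeight (n c r : ℕ) : ℝ :=
  (1 - r / n) ^ c * (1 - (r + 1) / n) ^ (n - 1 - r - c) *
    ∏ i ∈ Finset.range r, (1 - ((i : ℝ) + 1) / n)

/-- Here `m = n - 1 - r`. The ranges `i < c`, `c < i ≤ m` and `m < i` give the three factors of the
weight; the prefactor `n` cancels the `1 / n` of card `c`. -/
lemma prod_card_allowedPositions {n : ℕ} {c r : ℕ} (h : r + c < n) :
    n * ∏ i ∈ Finset.range n, (((if i < c then n - 1 - r + 1 else if i = c then 1
      else max (n - 1 - r) i : ℕ) : ℝ) / n) = lastWeight n c r := by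
  have hn : (n : ℝ) ≠ 0 := by
    have : n ≠ 0 := by omega
    exact_mod_cast this
  have hm : ((n - 1 - r : ℕ) : ℝ) = n - (r + 1) := by
    rw [Nat.sub_sub, Nat.cast_sub (by omega)]
    push_cast; ring
  set f : ℕ → ℝ := fun i => (((if i < c then n - 1 - r + 1 else if i = c then 1
      else max (n - 1 - r) i : ℕ) : ℝ) / n) with hf
  have e1 : ∏ i ∈ Finset.range c, f i = (1 - r / n) ^ c := by
    rw [Finset.prod_congr rfl (g := fun _ => 1 - (r : ℝ) / n), Finset.prod_const,
      Finset.card_range]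
    intro i hi
    simp only [hf, if_pos (Finset.mem_range.1 hi)]
    push_cast
    rw [hm]
    field_simp
    ring
  have e2 : f c = 1 / n := by simp [hf]
  have e3 : ∏ i ∈ Finset.Ico (c + 1) (n - r), f i = (1 - (r + 1) / n) ^ (n - 1 - r - c) := by
    rw [Finset.prod_congr rfl (g := fun _ => 1 - ((r : ℝ) + 1) / n), Finset.prod_const,
      Nat.card_Ico]
    · congr 1; omega
    intro i hi
    rw [Finset.mem_Ico] at hi
    simp only [hf, if_neg (show ¬ i < c by omega), if_neg (show ¬ i = c by omega),
      max_eq_left (show i ≤ n - 1 - r by omega)]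
    rw [hm]
    field_simp
  have e4 : ∏ i ∈ Finset.Ico (n - r) n, f i = ∏ i ∈ Finset.range r, (1 - ((i : ℝ) + 1) / n) := by
    rw [Finset.prod_Ico_eq_prod_range, ← Finset.prod_range_reflect, Nat.sub_sub_self (by omega)]
    refine Finset.prod_congr rfl fun i hi => ?_
    rw [Finset.mem_range] at hi
    have : n - r + (r - 1 - i) = n - (i + 1) := by omega
    rw [this]
    simp only [hf, if_neg (show ¬ n - (i + 1) < c by omega),
      if_neg (show ¬ n - (i + 1) = c by omega),
      max_eq_right (show n - 1 - r ≤ n - (i + 1) by omega)]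
    rw [Nat.cast_sub (by omega)]
    push_cast
    field_simp
  rw [← Finset.prod_range_mul_prod_Ico f (show c + 1 ≤ n by omega), Finset.prod_range_succ, e1, e2,
    ← Finset.prod_Ico_consecutive f (show c + 1 ≤ n - r by omega) (Nat.sub_le n r), e3, e4,
    lastWeight]
  field_simp

lemma probLast_eq_card {n : ℕ} (c : Fin (n + 1)) :
    probLast (n + 1) ((c : ℝ) + 1) =
      (Finset.univ.filter (fun k : Fin (n + 1) → Fin (n + 1) => EndsLast k c)).card /
        ((n + 1 : ℕ) : ℝ) ^ (n + 1) := by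
  have hset : (fun k => deckAfter 1 k (n + 1)) ⁻¹' {σ : Equiv.Perm (Fin (n + 1)) |
      (lastCard σ : ℝ) = (c : ℝ) + 1} = {k | EndsLast k c} := by
    ext k
    simp only [Set.mem_preimage, Set.mem_ofPred_eq, ← deckAfter_last_eq_iff, lastCard]
    push_cast
    rw [add_left_inj, Nat.cast_inj, Fin.ext_iff]
  rw [probLast, shuffleLaw, PMF.toOuterMeasure_map_apply, hset,
    PMF.toOuterMeasure_uniformOfFintype_apply, ENNReal.toReal_div]
  simp [Fintype.card_subtype]
  rw [← Nat.cast_succ, ENNReal.toReal_natCast, Nat.cast_succ]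

lemma mul_probLast {n c : ℕ} (h : c < n) :
    n * probLast n ((c : ℝ) + 1) = ∑ r ∈ Finset.range (n - c), lastWeight n c r := by
  obtain ⟨n, rfl⟩ : ∃ m, n = m + 1 := ⟨n - 1, by omega⟩
  have := probLast_eq_card ⟨c, h⟩
  rw [this, card_filter_endsLast]
  push_cast
  -- Reversing the sum over `r` makes its index the offset of the reinsertion position from `c`.
  rw [Finset.sum_div, Finset.mul_sum, ← Finset.sum_range_reflect]
  have hsum : ∀ g : Fin (n + 1) → ℝ, ∑ m ∈ Finset.Ici (⟨c, h⟩ : Fin (n + 1)), g m =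
      ∑ m ∈ Finset.range (n + 1 - c), if hm : c + m < n + 1 then g ⟨c + m, hm⟩ else 0 := by
    intro g
    refine Finset.sum_bij' (fun m _ => m.val - c) (fun m hm => Fin.ofNat (n + 1) (c + m))
      ?_ ?_ ?_ ?_ ?_
    · intro a ha
      have := Fin.le_def.1 (Finset.mem_Ici.1 ha)
      simp at this ⊢
      omega
    · intro a ha
      rw [Finset.mem_range] at ha
      rw [Finset.mem_Ici, Fin.le_def]
      simp [Nat.mod_eq_of_lt (show c + a < n + 1 by omega)]
    · intro a ha
      have := Fin.le_def.1 (Finset.mem_Ici.1 ha)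
      ext
      simp at this ⊢
      rw [Nat.mod_eq_of_lt (by omega)]
      omega
    · intro a ha
      rw [Finset.mem_range] at ha
      simp [Nat.mod_eq_of_lt (show c + a < n + 1 by omega)]
    · intro a ha
      have := Fin.le_def.1 (Finset.mem_Ici.1 ha)
      have h2 : c + (a.val - c) = a := by simp at this; omega
      simp [h2, (show ¬ n < a.val from not_lt.2 (Nat.lt_succ_iff.1 a.isLt))]
  rw [hsum]
  refine Finset.sum_congr rfl fun m hm => ?_
  rw [Finset.mem_range] at hm
  have hm' : c + m < n + 1 := by omega
  have hr : n + 1 - 1 - (n + 1 - c - 1 - m) = c + m := by omega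
  rw [dif_pos hm', ← prod_card_allowedPositions (by omega), hr,
    ← Fin.prod_univ_eq_prod_range (fun i => (((if i < c then c + m + 1 else if i = c then 1
      else max (c + m) i : ℕ) : ℝ) / (n + 1 : ℕ)))]
  rw [Finset.prod_div_distrib]
  simp only [card_allowedPositions]
  simp

/-! ### Geometric bound and limit of each weight. -/

lemma lastWeight_nonneg {n c r : ℕ} (h : r + c < n) : 0 ≤ lastWeight n c r := by
  have hn : (0 : ℝ) < n := by exact_mod_cast (show 0 < n by omega)
  have key : ∀ i : ℕ, i ≤ n → 0 ≤ 1 - (i : ℝ) / n := fun i hi =>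
    sub_nonneg.2 (div_le_one_of_le₀ (by exact_mod_cast hi) hn.le)
  have key' : ∀ i : ℕ, i + 1 ≤ n → 0 ≤ 1 - ((i : ℝ) + 1) / n := fun i hi => by
    exact_mod_cast key (i + 1) hi
  unfold lastWeight
  refine mul_nonneg (mul_nonneg (pow_nonneg (key r (by omega)) _)
    (pow_nonneg (key' r (by omega)) _)) (Finset.prod_nonneg fun i hi => key' i ?_)
  rw [Finset.mem_range] at hi
  omega

/-- Apply `1 - x ≤ e^(-x)` to every factor, weakening `(r + 1) / n` to `r / n` so that the bound no
longer depends on `c`. The resulting exponent is below `-r / 2` by `r (n - 1 - r) / (2n) ≥ 0`. -/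
lemma lastWeight_le {n c r : ℕ} (h : r + c < n) : lastWeight n c r ≤ Real.exp (-1 / 2) ^ r := by
  have hn : (0 : ℝ) < n := by exact_mod_cast (show 0 < n by omega)
  have key : ∀ i : ℕ, i ≤ n → 0 ≤ 1 - (i : ℝ) / n := fun i hi =>
    sub_nonneg.2 (div_le_one_of_le₀ (by exact_mod_cast hi) hn.le)
  have key' : ∀ i : ℕ, i + 1 ≤ n → 0 ≤ 1 - ((i : ℝ) + 1) / n := fun i hi => by
    exact_mod_cast key (i + 1) hi
  have e1 : 1 - (r : ℝ) / n ≤ Real.exp (-(r / n)) := Real.one_sub_le_exp_neg _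
  have e2 : 1 - ((r : ℝ) + 1) / n ≤ Real.exp (-(r / n)) := by
    refine le_trans ?_ e1
    gcongr
    linarith
  have e3 : ∏ i ∈ Finset.range r, (1 - ((i : ℝ) + 1) / n) ≤
      Real.exp (-(r * (r + 1) / 2 / n)) := by
    have hs : ∀ r : ℕ, (∑ i ∈ Finset.range r, -(((i : ℝ) + 1) / n)) = -(r * (r + 1) / 2 / n) := by
      intro r
      induction r with
      | zero => simp
      | succ r ih => rw [Finset.sum_range_succ, ih]; push_cast; field_simp; ring
    rw [← hs, Real.exp_sum]
    refine Finset.prod_le_prod (fun i hi => key' i ?_) fun i _ => Real.one_sub_le_exp_neg _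
    rw [Finset.mem_range] at hi
    omega
  have hcast : (c : ℝ) + (n - 1 - r - c : ℕ) = n - 1 - r := by
    have : c + (n - 1 - r - c) + 1 + r = n := by omega
    have : ((c + (n - 1 - r - c) + 1 + r : ℕ) : ℝ) = n := by exact_mod_cast this
    push_cast at this
    linarith
  have hr : (0 : ℝ) ≤ n - 1 - r := by rw [← hcast]; positivity
  calc lastWeight n c r ≤ Real.exp (-(r / n)) ^ c * Real.exp (-(r / n)) ^ (n - 1 - r - c) *
        Real.exp (-(r * (r + 1) / 2 / n)) := by
        unfold lastWeight
        have := key r (by omega)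
        have := key' r (by omega)
        gcongr
        exact Finset.prod_nonneg fun i hi => key' i (by rw [Finset.mem_range] at hi; omega)
    _ = Real.exp (-(r / n) * (n - 1 - r) - r * (r + 1) / 2 / n) := by
        rw [← pow_add, ← Real.exp_nat_mul, ← Real.exp_add]
        push_cast
        rw [hcast]
        ring_nf
    _ ≤ Real.exp (-1 / 2) ^ r := by
        rw [← Real.exp_nat_mul, Real.exp_le_exp]
        have : (r : ℝ) * (-1 / 2) - (-(r / n) * (n - 1 - r) - r * (r + 1) / 2 / n) =
            r * (n - 1 - r) / (2 * n) := by field_simp; ring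
        have h2 : 0 ≤ (r : ℝ) * (n - 1 - r) / (2 * n) := by positivity
        linarith

/-- The power is `((1 - a / n) ^ n) ^ (k n / n)` once the base is positive. -/
lemma tendsto_one_sub_div_pow {a b : ℝ} {k : ℕ → ℕ}
    (hk : Tendsto (fun n => (k n : ℝ) / n) atTop (𝓝 b)) :
    Tendsto (fun n : ℕ => (1 - a / n) ^ k n) atTop (𝓝 (Real.exp (-a * b))) := by
  have h1 : Tendsto (fun n : ℕ => (1 - a / n) ^ n) atTop (𝓝 (Real.exp (-a))) := by
    simpa [neg_div, sub_eq_add_neg] using Real.tendsto_one_add_div_pow_exp (-a)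
  have h2 := h1.rpow hk (Or.inl (Real.exp_ne_zero _))
  rw [← Real.exp_mul] at h2
  refine h2.congr' ?_
  have h3 : Tendsto (fun n : ℕ => 1 - a / n) atTop (𝓝 1) := by
    simpa using tendsto_const_nhds.sub (tendsto_const_div_atTop_nhds_zero_nat a)
  filter_upwards [h3.eventually (lt_mem_nhds zero_lt_one), eventually_gt_atTop 0] with n hn hn0
  have : (n : ℝ) ≠ 0 := by exact_mod_cast hn0.ne'
  rw [← Real.rpow_natCast, ← Real.rpow_mul hn.le, mul_div_cancel₀ _ this, Real.rpow_natCast]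

lemma tendsto_lastWeight {b : ℝ} {c : ℕ → ℕ} (r : ℕ)
    (hc : Tendsto (fun n => (c n : ℝ) / n) atTop (𝓝 b)) (hr : ∀ᶠ n in atTop, r + c n < n) :
    Tendsto (fun n => lastWeight n (c n) r) atTop
      (𝓝 (Real.exp (b - 1) * Real.exp (-1) ^ r)) := by
  have h1 : Tendsto (fun n => ((n - 1 - r - c n : ℕ) : ℝ) / n) atTop (𝓝 (1 - b)) := by
    have h0 := (tendsto_const_nhds (x := (1 : ℝ))).sub
      ((tendsto_const_div_atTop_nhds_zero_nat ((r : ℝ) + 1)).add hc)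
    rw [zero_add] at h0
    refine h0.congr' ?_
    filter_upwards [hr] with n hn
    have hn0 : (n : ℝ) ≠ 0 := by exact_mod_cast (show n ≠ 0 by omega)
    rw [show n - 1 - r - c n = n - (r + 1 + c n) by omega, Nat.cast_sub (by omega)]
    push_cast
    field_simp
  have h2 : Tendsto (fun n : ℕ => ∏ i ∈ Finset.range r, (1 - ((i : ℝ) + 1) / n)) atTop (𝓝 1) := by
    have := tendsto_finsetProd (Finset.range r) fun i _ =>
      (tendsto_const_nhds (x := (1 : ℝ))).sub
        (tendsto_const_div_atTop_nhds_zero_nat ((i : ℝ) + 1))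
    simpa using this
  have h3 := ((tendsto_one_sub_div_pow (a := r) hc).mul
    (tendsto_one_sub_div_pow (a := (r : ℝ) + 1) h1)).mul h2
  unfold lastWeight
  convert h3 using 2
  rw [mul_one, ← Real.exp_nat_mul, ← Real.exp_add, ← Real.exp_add]
  ring_nf

/-! ### Local limits by dominated convergence. -/

lemma summable_exp_neg_half_pow : Summable fun r : ℕ => Real.exp (-1 / 2) ^ r :=
  summable_geometric_of_lt_one (Real.exp_pos _).le (Real.exp_lt_one_iff.2 (by norm_num))

lemma mul_probLast_eq_tsum {n c : ℕ} (h : c < n) :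
    n * probLast n ((c : ℝ) + 1) = ∑' r, if r + c < n then lastWeight n c r else 0 := by
  rw [mul_probLast h, tsum_eq_sum (s := Finset.range (n - c))]
  · refine Finset.sum_congr rfl fun r hr => ?_
    rw [Finset.mem_range] at hr
    rw [if_pos (by omega)]
  · intro r hr
    rw [Finset.mem_range] at hr
    rw [if_neg (by omega)]

lemma norm_ite_lastWeight_le (n c r : ℕ) :
    ‖if r + c < n then lastWeight n c r else 0‖ ≤ Real.exp (-1 / 2) ^ r := by
  split_ifs with h
  · rw [Real.norm_of_nonneg (lastWeight_nonneg h)]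
    exact lastWeight_le h
  · simp [(Real.exp_pos _).le]

lemma norm_mul_probLast_le {n c : ℕ} (h : c < n) :
    ‖n * probLast n ((c : ℝ) + 1)‖ ≤ ∑' r : ℕ, Real.exp (-1 / 2) ^ r := by
  rw [mul_probLast_eq_tsum h]
  exact tsum_of_norm_bounded summable_exp_neg_half_pow.hasSum (norm_ite_lastWeight_le n c)

-- `S` selects the indices `r` that eventually occur in the sum: all of them in (i) and (ii), those
-- with `r ≤ l` in (iii).
open Classical in
lemma tendsto_mul_probLast {b : ℝ} {c : ℕ → ℕ} (S : ℕ → Prop)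
    (hcn : ∀ᶠ n in atTop, c n < n)
    (hc : Tendsto (fun n => (c n : ℝ) / n) atTop (𝓝 b))
    (hS : ∀ r, ∀ᶠ n in atTop, r + c n < n ↔ S r) :
    Tendsto (fun n : ℕ => n * probLast n ((c n : ℝ) + 1)) atTop
      (𝓝 (∑' r, if S r then Real.exp (b - 1) * Real.exp (-1) ^ r else 0)) := by
  have hlim : Tendsto (fun n => ∑' r, if r + c n < n then lastWeight n (c n) r else 0) atTop
      (𝓝 (∑' r, if S r then Real.exp (b - 1) * Real.exp (-1) ^ r else 0)) := by
    refine tendsto_tsum_of_dominated_convergence summable_exp_neg_half_pow (fun r => ?_)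
      (Eventually.of_forall fun n r => norm_ite_lastWeight_le n (c n) r)
    by_cases hr : S r
    · rw [if_pos hr]
      have hr' : ∀ᶠ n in atTop, r + c n < n := (hS r).mono fun n hn => hn.2 hr
      refine (tendsto_lastWeight r hc hr').congr' ?_
      filter_upwards [hr'] with n hn
      rw [if_pos hn]
    · rw [if_neg hr]
      refine tendsto_const_nhds.congr' ?_
      filter_upwards [hS r] with n hn
      rw [if_neg (mt hn.1 hr)]
  refine hlim.congr' ?_
  filter_upwards [hcn] with n hn
  rw [mul_probLast_eq_tsum hn]

lemma tendsto_mul_probLast_of_tendsto_sub {b : ℝ} {c : ℕ → ℕ}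
    (hc : Tendsto (fun n => (c n : ℝ) / n) atTop (𝓝 b))
    (hr : ∀ r, ∀ᶠ n in atTop, r + c n < n) :
    Tendsto (fun n : ℕ => n * probLast n ((c n : ℝ) + 1)) atTop
      (𝓝 (Real.exp b / (Real.exp 1 - 1))) := by
  have h := tendsto_mul_probLast (fun _ => True) ((hr 0).mono fun n hn => by omega) hc
    fun r => (hr r).mono fun n hn => iff_of_true hn trivial
  convert h using 2
  have he : Real.exp 1 - 1 ≠ 0 :=
    (sub_pos.2 (Real.one_lt_exp_iff.2 one_pos)).ne'
  simp only [if_true]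
  rw [tsum_mul_left, tsum_geometric_of_lt_one (Real.exp_pos _).le (Real.exp_lt_one_iff.2 (by norm_num)),
    Real.exp_sub, Real.exp_neg]
  field_simp

lemma tendsto_mul_probLast_of_lt_one {b : ℝ} {c : ℕ → ℕ} (hb : b < 1)
    (hc : Tendsto (fun n => (c n : ℝ) / n) atTop (𝓝 b)) :
    Tendsto (fun n : ℕ => n * probLast n ((c n : ℝ) + 1)) atTop
      (𝓝 (Real.exp b / (Real.exp 1 - 1))) := by
  refine tendsto_mul_probLast_of_tendsto_sub hc fun r => ?_
  have h := (tendsto_const_div_atTop_nhds_zero_nat (r : ℝ)).add hc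
  rw [zero_add] at h
  filter_upwards [h.eventually (gt_mem_nhds hb), eventually_gt_atTop 0] with n hn hn0
  have : (0 : ℝ) < n := by exact_mod_cast hn0
  rw [← add_div, div_lt_one this] at hn
  exact_mod_cast hn

lemma tendsto_mul_probLast_sub (l : ℕ) :
    Tendsto (fun n : ℕ => (n : ℝ) * probLast n ((n : ℝ) - l)) atTop
      (𝓝 ((Real.exp 1 - Real.exp (-(l : ℝ))) / (Real.exp 1 - 1))) := by
  have hc : Tendsto (fun n : ℕ => ((n - (l + 1) : ℕ) : ℝ) / n) atTop (𝓝 1) := by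
    have h := (tendsto_const_nhds (x := (1 : ℝ))).sub
      (tendsto_const_div_atTop_nhds_zero_nat ((l : ℝ) + 1))
    rw [sub_zero] at h
    refine h.congr' ?_
    filter_upwards [eventually_gt_atTop l] with n hn
    have hn0 : (n : ℝ) ≠ 0 := by exact_mod_cast (show n ≠ 0 by omega)
    rw [Nat.cast_sub (by omega)]
    push_cast
    field_simp
  have h := tendsto_mul_probLast (fun r => r ≤ l)
    ((eventually_gt_atTop l).mono fun n hn => by omega) hc
    fun r => (eventually_gt_atTop l).mono fun n hn => by omega
  have he : Real.exp 1 - 1 ≠ 0 :=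
    (sub_pos.2 (Real.one_lt_exp_iff.2 one_pos)).ne'
  have hsum : (∑' r : ℕ, if r ≤ l then Real.exp (1 - 1) * Real.exp (-1) ^ r else 0) =
      (Real.exp 1 - Real.exp (-(l : ℝ))) / (Real.exp 1 - 1) := by
    rw [tsum_eq_sum (s := Finset.range (l + 1))]
    · rw [Finset.sum_congr rfl (g := fun r => Real.exp (-1) ^ r), geom_sum_eq
        (Real.exp_lt_one_iff.2 (by norm_num)).ne]
      · rw [show -(l : ℝ) = l * (-1) by ring, Real.exp_nat_mul, pow_succ, Real.exp_neg]
        have h1 : 1 - Real.exp 1 ≠ 0 := sub_ne_zero.2 (sub_ne_zero.1 he).symm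
        have h2 : (Real.exp 1)⁻¹ - 1 = (1 - Real.exp 1) / Real.exp 1 := by field_simp
        rw [h2]
        field_simp
        ring
      · intro r hr
        rw [Finset.mem_range] at hr
        rw [if_pos (by omega), sub_self, Real.exp_zero, one_mul]
    · intro r hr
      rw [Finset.mem_range] at hr
      rw [if_neg (by omega)]
  rw [← hsum]
  have h' : Tendsto (fun n : ℕ => (n : ℝ) * probLast n ((n : ℝ) - l)) atTop _ := h.congr' <| by
    filter_upwards [eventually_gt_atTop l] with n hn
    rw [Nat.cast_sub (by omega)]
    push_cast
    ring_nf
  convert h' using 2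
  -- The two sums differ only in the decidability instance of `r ≤ l`.
  congr!

lemma exists_tendsto_of_eventually {b : ℝ} {bs : ℕ → ℝ}
    (h : ∀ᶠ n : ℕ in atTop, ∃ j : ℕ, 1 ≤ j ∧ j ≤ n ∧ bs n * n = j)
    (hb : Tendsto bs atTop (𝓝 b)) :
    ∃ c : ℕ → ℕ, (∀ᶠ n : ℕ in atTop, bs n * n = (c n : ℝ) + 1) ∧
      Tendsto (fun n => (c n : ℝ) / n) atTop (𝓝 b) := by
  have h' : ∀ᶠ n : ℕ in atTop, ∃ c : ℕ, bs n * n = (c : ℝ) + 1 := h.mono fun n ⟨j, hj, _, e⟩ =>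
    ⟨j - 1, by rw [e, Nat.cast_sub hj]; simp⟩
  obtain ⟨c, hc⟩ := h'.choice
  refine ⟨c, hc, ?_⟩
  have h1 := hb.sub (tendsto_const_div_atTop_nhds_zero_nat (1 : ℝ))
  rw [sub_zero] at h1
  refine h1.congr' ?_
  filter_upwards [hc, eventually_gt_atTop 0] with n hn hn0
  have : (n : ℝ) ≠ 0 := by exact_mod_cast hn0.ne'
  field_simp
  linarith

/-! ### Weak convergence of the rescaled last card. -/

lemma intervalIntegral_nat_floor_mul {n : ℕ} (hn : 0 < n) (G : ℕ → ℝ) :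
    ∫ x in (0 : ℝ)..1, G ⌊(n : ℝ) * x⌋₊ = (∑ c ∈ Finset.range n, G c) / n := by
  have hn0 : (0 : ℝ) < n := by exact_mod_cast hn
  have hle : ∀ c : ℕ, (c : ℝ) / n ≤ ((c + 1 : ℕ) : ℝ) / n := fun c => by
    gcongr; simp
  have heq : ∀ c : ℕ, Set.EqOn (fun _ => G c) (fun x => G ⌊(n : ℝ) * x⌋₊)
      (Set.Ioo ((c : ℝ) / n) (((c + 1 : ℕ) : ℝ) / n)) := by
    intro c x hx
    have h1 := (div_lt_iff₀ hn0).1 hx.1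
    have h2 := (lt_div_iff₀ hn0).1 hx.2
    have : ⌊(n : ℝ) * x⌋₊ = c := by
      rw [Nat.floor_eq_iff (by linarith [(Nat.cast_nonneg c : (0 : ℝ) ≤ c)])]
      push_cast at h2
      constructor <;> linarith
    simp only [this]
  have h := intervalIntegral.sum_integral_adjacent_intervals (μ := volume)
    (f := fun x : ℝ => G ⌊(n : ℝ) * x⌋₊) (a := fun c : ℕ => (c : ℝ) / n) (n := n)
    fun c _ => (intervalIntegrable_const (c := G c)).congr_uIoo (by
      rw [Set.uIoo_of_le (hle c)]; exact heq c)
  simp only [Nat.cast_zero, zero_div, div_self hn0.ne'] at h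
  rw [← h, Finset.sum_div]
  refine Finset.sum_congr rfl fun c _ => ?_
  rw [← intervalIntegral.integral_congr_Ioo_of_le (hle c) (heq c),
    intervalIntegral.integral_const, smul_eq_mul]
  push_cast
  field_simp
  ring

lemma integral_nuLast {n : ℕ} (hn : 0 < n) (f : unitInterval → ℝ) (hf : Continuous f) :
    ∫ x, f x ∂(nuLast n : Measure unitInterval) =
      ∑ c ∈ Finset.range n, probLast n ((c : ℝ) + 1) *
        Set.IccExtend zero_le_one f (((c : ℝ) + 1) / n) := by
  obtain ⟨n, rfl⟩ : ∃ m, n = m + 1 := ⟨n - 1, by omega⟩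
  let g : Fin (n + 1) → unitInterval := fun c => Set.projIcc 0 1 zero_le_one
    (((c : ℝ) + 1) / (n + 1 : ℕ))
  let P : PMF (Fin (n + 1)) := (shuffleLaw (1 : Equiv.Perm (Fin (n + 1)))).map
    fun σ => σ (Fin.last n)
  have hmap : (shuffleLaw (1 : Equiv.Perm (Fin (n + 1)))).map scaledLast = P.map g := by
    rw [PMF.map_comp]
    congr 1
    ext σ
    have : (((σ (Fin.last n)).val : ℝ) + 1) / (n + 1 : ℕ) ∈ Set.Icc (0 : ℝ) 1 := by
      refine ⟨by positivity, div_le_one_of_le₀ ?_ (Nat.cast_nonneg _)⟩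
      exact_mod_cast (σ (Fin.last n)).isLt
    simp only [g, Function.comp, scaledLast, lastCard]
    rw [Set.projIcc_of_mem _ this]
    push_cast
    rfl
  have hP : ∀ c, (P c).toReal = probLast (n + 1) ((c : ℝ) + 1) := by
    intro c
    rw [← PMF.toOuterMeasure_apply_singleton, probLast, PMF.toOuterMeasure_map_apply]
    congr 2
    ext σ
    simp only [Set.mem_preimage, Set.mem_singleton_iff, Set.mem_ofPred_eq, lastCard]
    push_cast
    rw [add_left_inj, Nat.cast_inj, Fin.ext_iff]
  have hg : Measurable g := measurable_of_countable g
  change ∫ x, f x ∂((shuffleLaw (1 : Equiv.Perm (Fin (n + 1)))).map scaledLast).toMeasure = _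
  rw [hmap, ← PMF.toMeasure_map g P hg,
    integral_map hg.aemeasurable hf.aestronglyMeasurable, PMF.integral_eq_sum,
    ← Fin.sum_univ_eq_sum_range (fun c => probLast (n + 1) ((c : ℝ) + 1) *
        Set.IccExtend zero_le_one f (((c : ℝ) + 1) / (n + 1 : ℕ)))]
  simp only [hP, smul_eq_mul]
  rfl

lemma integral_limitLaw (f : unitInterval → ℝ) :
    ∫ x, f x ∂(limitLaw : Measure unitInterval) =
      ∫ x in (0 : ℝ)..1, Real.exp x / (Real.exp 1 - 1) * Set.IccExtend zero_le_one f x := by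
  have he : (0 : ℝ) < Real.exp 1 - 1 := sub_pos.2 (Real.one_lt_exp_iff.2 one_pos)
  change ∫ x, f x ∂limitMeasure = _
  rw [limitMeasure, integral_withDensity_eq_integral_toReal_smul (by fun_prop)
    (Eventually.of_forall fun _ => ENNReal.ofReal_lt_top),
    intervalIntegral.integral_of_le zero_le_one, ← integral_Icc_eq_integral_Ioc,
    ← integral_subtype_comap measurableSet_Icc]
  refine integral_congr_ae (Eventually.of_forall fun x => ?_)
  have : 0 ≤ Real.exp (x : ℝ) / (Real.exp 1 - 1) := by positivity
  simp only [ENNReal.toReal_ofReal this, smul_eq_mul, Set.IccExtend_val]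

/-- The integral of `f` against `nuLast n` is a sum over cards, hence the integral of a step
function of `⌊n x⌋₊`. This converges pointwise by the local limit with `c = ⌊n x⌋₊`, under a
constant bound. -/
lemma tendsto_nuLast : Tendsto nuLast atTop (𝓝 limitLaw) := by
  rw [ProbabilityMeasure.tendsto_iff_forall_integral_tendsto]
  intro f
  set F : ℝ → ℝ := Set.IccExtend zero_le_one f with hF
  have hFc : Continuous F := f.continuous.Icc_extend'
  have hFb : ∀ x, ‖F x‖ ≤ ‖f‖ := fun x => f.norm_coe_le_norm _
  let G : ℕ → ℕ → ℝ := fun n c => n * probLast n ((c : ℝ) + 1) * F (((c : ℝ) + 1) / n)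
  have hlim : Tendsto (fun n : ℕ => ∫ x in (0 : ℝ)..1, G n ⌊(n : ℝ) * x⌋₊) atTop
      (𝓝 (∫ x in (0 : ℝ)..1, Real.exp x / (Real.exp 1 - 1) * F x)) := by
    refine intervalIntegral.tendsto_integral_filter_of_dominated_convergence
      (fun _ => (∑' r : ℕ, Real.exp (-1 / 2) ^ r) * ‖f‖) ?_ ?_ intervalIntegrable_const ?_
    · refine Eventually.of_forall fun n => Measurable.aestronglyMeasurable ?_
      exact (measurable_from_top (f := G n)).comp
        (Nat.measurable_floor.comp (measurable_const_mul (n : ℝ)))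
    · filter_upwards [eventually_gt_atTop 0] with n hn
      have hn0 : (0 : ℝ) < n := by exact_mod_cast hn
      -- At `x = 1` the floor is `n`, which numbers no card.
      filter_upwards [Measure.ae_ne volume (1 : ℝ)] with x hx1 hx
      rw [Set.uIoc_of_le zero_le_one] at hx
      have hlt : ⌊(n : ℝ) * x⌋₊ < n := by
        rw [Nat.floor_lt (by have := hx.1; positivity)]
        exact mul_lt_of_lt_one_right hn0 (hx.2.lt_of_ne hx1)
      rw [norm_mul]
      have := norm_mul_probLast_le hlt
      gcongr
      exact hFb _
    · filter_upwards [Measure.ae_ne volume (1 : ℝ)] with x hx1 hx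
      rw [Set.uIoc_of_le zero_le_one] at hx
      have hfl : Tendsto (fun n : ℕ => (⌊(n : ℝ) * x⌋₊ : ℝ) / n) atTop (𝓝 x) := by
        simpa [mul_comm, Function.comp_def] using
          (tendsto_nat_floor_mul_div_atTop hx.1.le).comp (tendsto_natCast_atTop_atTop (R := ℝ))
      refine (tendsto_mul_probLast_of_lt_one (hx.2.lt_of_ne hx1) hfl).mul
        ((hFc.tendsto x).comp ?_)
      have := hfl.add (tendsto_const_div_atTop_nhds_zero_nat (1 : ℝ))
      simpa [add_div] using this
  rw [integral_limitLaw]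
  refine hlim.congr' ?_
  filter_upwards [eventually_gt_atTop 0] with n hn
  have hn0 : (n : ℝ) ≠ 0 := by exact_mod_cast hn.ne'
  rw [intervalIntegral_nat_floor_mul hn (G n), integral_nuLast hn _ f.continuous, Finset.sum_div]
  refine Finset.sum_congr rfl fun c _ => ?_
  simp only [G]
  field_simp
  rfl

end CardCyclic

theorem theorem2 :
    -- (i), the local limit
    (∀ (b : ℝ) (bs : ℕ → ℝ), 0 ≤ b → b < 1 →
      (∀ᶠ n : ℕ in atTop, ∃ j : ℕ, 1 ≤ j ∧ j ≤ n ∧ bs n * n = j) →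
      Tendsto bs atTop (𝓝 b) →
      Tendsto (fun n : ℕ => (n : ℝ) * CardCyclic.probLast n (bs n * n)) atTop
        (𝓝 (Real.exp b / (Real.exp 1 - 1)))) ∧
    -- (i), weak convergence of the law of the rescaled last card
    Tendsto CardCyclic.nuLast atTop (𝓝 CardCyclic.limitLaw) ∧
    -- (ii)
    (∀ bs : ℕ → ℝ,
      (∀ᶠ n : ℕ in atTop, ∃ j : ℕ, 1 ≤ j ∧ j ≤ n ∧ bs n * n = j) →
      Tendsto bs atTop (𝓝 1) →
      Tendsto (fun n : ℕ => (n : ℝ) - bs n * n) atTop atTop →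
      Tendsto (fun n : ℕ => (n : ℝ) * CardCyclic.probLast n (bs n * n)) atTop
        (𝓝 (Real.exp 1 / (Real.exp 1 - 1)))) ∧
    -- (iii)
    (∀ l : ℕ,
      Tendsto (fun n : ℕ => (n : ℝ) * CardCyclic.probLast n ((n : ℝ) - l)) atTop
        (𝓝 ((Real.exp 1 - Real.exp (-(l : ℝ))) / (Real.exp 1 - 1)))) := by
  refine ⟨fun b bs _ hb1 hbs hb => ?_, CardCyclic.tendsto_nuLast, fun bs hbs hb hsub => ?_,
    CardCyclic.tendsto_mul_probLast_sub⟩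
  · obtain ⟨c, hc, hcb⟩ := CardCyclic.exists_tendsto_of_eventually hbs hb
    refine (CardCyclic.tendsto_mul_probLast_of_lt_one hb1 hcb).congr' ?_
    filter_upwards [hc] with n hn
    rw [hn]
  · obtain ⟨c, hc, hcb⟩ := CardCyclic.exists_tendsto_of_eventually hbs hb
    -- Divergence of `n - bs n * n` makes every `r` occur eventually, so the full geometric series
    -- survives although `b = 1`.
    have hr : ∀ r, ∀ᶠ n in atTop, r + c n < n := fun r => by
      filter_upwards [hc, hsub.eventually_ge_atTop (r : ℝ)] with n hn hn'
      rw [hn] at hn'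
      have : (r : ℝ) + (c n + 1) ≤ n := by linarith
      have : r + (c n + 1) ≤ n := by exact_mod_cast this
      omega
    refine (CardCyclic.tendsto_mul_probLast_of_tendsto_sub hcb hr).congr' ?_
    filter_upwards [hc] with n hn
    rw [hn]
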